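/- Let $S \subset {]0,+\infty[}$. An \emph{ordered ultrametric space} is a metric space $(X,d)$ satisfying $d(x,z)\le\max(d(x,y),d(y,z))$ for all $x,y,z\in X$, together with a linear ordering $<$ of $X$; the ordering is \emph{convex} if every metric ball of $X$ is $<$-convex. Let $\mathcal{U}^{c<}_S$ be the class of all finite ordered ultrametric spaces whose ordering is convex and in which the distance between any two distinct points belongs to $S$. Two ordered ultrametric spaces are isomorphic if there is an order preserving isometry from one onto the other, and $\binom{Z}{X}$ denotes the set of all subspaces of $Z$ (with the induced metric and ordering) that are isomorphic to $X$. Then $\mathcal{U}^{c<}_S$ has the Ramsey property: for all $X, Y \in \mathcal{U}^{c<}_S$ and every integer $k \ge 1$ there is $Z \in \mathcal{U}^{c<}_S$ such that $Z \longrightarrow (Y)^{X}_{k}$, that is, for every map $\chi : \binom{Z}{X} \to \{0,\dots,k-1\}$ there is $\widetilde{Y} \in \binom{Z}{Y}$ such that $\chi$ takes at most one value on $\binom{\widetilde{Y}}{X}$. -/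

import Mathlib

universe u

/-- An ordered ultrametric space: an ultrametric space together with a linear ordering of its
underlying set.  No compatibility between the metric and the ordering is required here. -/
structure OrdUltrametricSpace : Type (u + 1) where
  carrier : Type u
  [metricSpace : MetricSpace carrier]
  [isUltrametricDist : IsUltrametricDist carrier]
  [linearOrder : LinearOrder carrier]

namespace OrdUltrametricSpace

attribute [instance] OrdUltrametricSpace.metricSpace OrdUltrametricSpace.isUltrametricDist
  OrdUltrametricSpace.linearOrder

/-- The ordering is convex: all metric balls, open and closed, are order-convex. -/
def ConvexlyOrdered (X : OrdUltrametricSpace.{u}) : Prop :=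
  ∀ (x : X.carrier) (r : ℝ),
    (Metric.ball x r).OrdConnected ∧ (Metric.closedBall x r).OrdConnected

/-- The distance between any two distinct points lies in `S`. -/
def DistancesIn (X : OrdUltrametricSpace.{u}) (S : Set ℝ) : Prop :=
  ∀ x y : X.carrier, x ≠ y → dist x y ∈ S

/-- The class of finite convexly ordered ultrametric spaces with distances in `S`. -/
def finiteConvexlyOrdered (S : Set ℝ) : Set OrdUltrametricSpace.{u} :=
  {X | Finite X.carrier ∧ X.ConvexlyOrdered ∧ X.DistancesIn S}

/-- The set of all subspaces of `Z` (with the induced metric and ordering) which are isomorphic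
to `X`, that is, which are the image of `X` under an order preserving surjective isometry. -/
def copies (Z X : OrdUltrametricSpace.{u}) : Set (Set Z.carrier) :=
  {A | ∃ e : X.carrier ≃o A, Isometry e}

/-- The arrow relation `Z ⟶ (Y)^X_k`: for every colouring of the copies of `X` in `Z` with `k`
colours there is a copy `B` of `Y` in `Z` such that all the copies of `X` contained in `B`
have the same colour. -/
def Arrows (Z Y X : OrdUltrametricSpace.{u}) (k : ℕ) : Prop :=
  ∀ χ : Z.copies X → Fin k, ∃ B ∈ Z.copies Y,
    ∀ A A' : Z.copies X, A.1 ⊆ B → A'.1 ⊆ B → χ A = χ A'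

/-- The Ramsey property of a class `K` of ordered ultrametric spaces. -/
def RamseyProperty (K : Set OrdUltrametricSpace.{u}) : Prop :=
  ∀ X ∈ K, ∀ Y ∈ K, ∀ k : ℕ, 0 < k → ∃ Z ∈ K, Z.Arrows Y X k

end OrdUltrametricSpace

/-!
An order preserving isometric embedding `f : X → Y` carries the pairs (level `s`, open ball of
radius `s`), ordered by level and then by the convex order of `X`, in an order preserving way to
those of `Y`. Conversely, labelling the balls of `X` increasingly by a finite linear order `L` and
sending a point to the family of labels of the balls around it embeds `X` into the functions
`D → L`, with the colexicographic order and the largest level of disagreement as distance. The two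
constructions are compatible, so the arrow relation for ultrametric spaces follows from the one for
finite linear orders, which is Ramsey's theorem.
-/

section Ramsey

open Finset

variable {α κ : Type*} {χ : Finset α → κ} {n : ℕ} {B C : Finset α}

/-- A set is monochromatic for a colouring of `n`-subsets if all its `n`-subsets have the same
colour. Colourings are defined on all finite sets; only their values on `n`-subsets matter. -/
def IsMonochromatic (χ : Finset α → κ) (n : ℕ) (B : Finset α) : Prop :=
  ∃ i, ∀ A ∈ B.powersetCard n, χ A = i

/-- A set is end-monochromatic for a colouring of `(n + 1)`-subsets if the colour of each of its
`(n + 1)`-subsets depends only on the least element: this is the intermediate notion in the proof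
of Ramsey's theorem. -/
def IsEndMonochromatic [LinearOrder α] (χ : Finset α → κ) (n : ℕ) (B : Finset α) : Prop :=
  ∃ c : α → κ, ∀ v ∈ B, ∀ A ∈ (B.filter (v < ·)).powersetCard n, χ (insert v A) = c v

/-- The arrow `N ⟶ (m)ⁿ_κ`: for every colouring of the `n`-subsets of a set with at least `N`
elements by `κ` there is a monochromatic subset with `m` elements. -/
def CardArrows (κ : Type*) (N m n : ℕ) : Prop :=
  ∀ ⦃α : Type u⦄ (V : Finset α) (χ : Finset α → κ), N ≤ #V →
    ∃ B ⊆ V, #B = m ∧ IsMonochromatic χ n B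

theorem IsMonochromatic.mono (hC : IsMonochromatic χ n C) (hBC : B ⊆ C) :
    IsMonochromatic χ n B :=
  hC.imp fun _ hi A hA => hi A (powersetCard_mono hBC hA)

theorem isMonochromatic_zero (χ : Finset α → κ) (B : Finset α) : IsMonochromatic χ 0 B :=
  ⟨χ ∅, by simp⟩

theorem isEndMonochromatic_insert [LinearOrder α] {v : α} (hv : ∀ b ∈ B, v < b)
    (hB : IsEndMonochromatic χ n B) (hvB : IsMonochromatic (fun A => χ (insert v A)) n B) :
    IsEndMonochromatic χ n (insert v B) := by
  obtain ⟨c, hc⟩ := hB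
  obtain ⟨i, hi⟩ := hvB
  have filter_insert_eq {w : α} (hvw : v ≤ w) :
      (insert v B).filter (w < ·) = B.filter (w < ·) := by
    rw [filter_insert, if_neg hvw.not_gt]
  refine ⟨Function.update c v i, fun w hw A hA => ?_⟩
  obtain rfl | hwB := mem_insert.1 hw
  · rw [filter_insert_eq le_rfl] at hA
    rw [Function.update_self]
    exact hi A (powersetCard_mono (filter_subset _ _) hA)
  · rw [filter_insert_eq (hv w hwB).le] at hA
    rw [Function.update_of_ne (hv w hwB).ne']
    exact hc w hwB A hA

theorem exists_isEndMonochromatic (h : ∀ m, ∃ N, CardArrows.{u} κ N m n) (t : ℕ) :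
    ∃ N, ∀ ⦃α : Type u⦄ [LinearOrder α] (V : Finset α) (χ : Finset α → κ), N ≤ #V →
      ∃ B ⊆ V, #B = t ∧ IsEndMonochromatic χ n B := by
  induction t with
  | zero => exact ⟨0, fun _ _ _ χ _ => ⟨∅, empty_subset _, card_empty, fun v => χ {v}, by simp⟩⟩
  | succ t ih =>
    obtain ⟨N, hN⟩ := ih
    obtain ⟨M, hM⟩ := h N
    refine ⟨M + 1, fun α _ V χ hV => ?_⟩
    have hne : V.Nonempty := card_pos.1 (by omega)
    let v := V.min' hne
    have hv : v ∈ V := V.min'_mem hne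
    obtain ⟨W, hWV, hWcard, hW⟩ := hM (V.erase v) (fun A => χ (insert v A))
      (by rw [card_erase_of_mem hv]; omega)
    obtain ⟨B, hBW, hBcard, hB⟩ := hN W χ hWcard.ge
    have hlt : ∀ b ∈ B, v < b := fun b hb => V.min'_lt_of_mem_erase_min' hne (hWV (hBW hb))
    refine ⟨insert v B, insert_subset hv ((hBW.trans hWV).trans (erase_subset _ _)), ?_,
      isEndMonochromatic_insert hlt hB (hW.mono hBW)⟩
    rw [card_insert_of_notMem fun hvB => (hlt v hvB).false, hBcard]

theorem IsEndMonochromatic.exists_isMonochromatic [LinearOrder α] [Fintype κ]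
    (hC : IsEndMonochromatic χ n C) {m : ℕ} (hcard : Fintype.card κ * m ≤ #C) :
    ∃ B ⊆ C, #B = m ∧ IsMonochromatic χ (n + 1) B := by
  classical
  obtain ⟨c, hc⟩ := hC
  obtain ⟨i, -, hi⟩ := exists_le_card_fiber_of_mul_le_card_of_maps_to
    (fun a (_ : a ∈ C) => mem_univ (c a)) ⟨χ ∅, mem_univ _⟩ hcard
  obtain ⟨B, hBi, hBcard⟩ := exists_subset_card_eq hi
  have hBC : B ⊆ C := hBi.trans (filter_subset _ _)
  refine ⟨B, hBC, hBcard, i, fun A hA => ?_⟩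
  obtain ⟨hAB, hAcard⟩ := mem_powersetCard.1 hA
  have hne : A.Nonempty := card_pos.1 (by omega)
  have hv := A.min'_mem hne
  have htail : A.erase (A.min' hne) ∈ (C.filter (A.min' hne < ·)).powersetCard n := by
    refine mem_powersetCard.2 ⟨fun a ha => mem_filter.2 ⟨hBC (hAB (mem_of_mem_erase ha)), ?_⟩, ?_⟩
    · exact A.min'_lt_of_mem_erase_min' hne ha
    · rw [card_erase_of_mem hv, hAcard, Nat.add_sub_cancel]
  calc χ A = χ (insert (A.min' hne) (A.erase (A.min' hne))) := by rw [insert_erase hv]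
    _ = c (A.min' hne) := hc _ (hBC (hAB hv)) _ htail
    _ = i := (mem_filter.1 (hBi (hAB hv))).2

theorem exists_cardArrows [Finite κ] (m n : ℕ) : ∃ N, CardArrows.{u} κ N m n := by
  cases nonempty_fintype κ
  induction n generalizing m with
  | zero =>
    refine ⟨m, fun α V χ hV => ?_⟩
    obtain ⟨B, hBV, hB⟩ := exists_subset_card_eq hV
    exact ⟨B, hBV, hB, isMonochromatic_zero χ B⟩
  | succ n ih =>
    obtain ⟨N, hN⟩ := exists_isEndMonochromatic ih (Fintype.card κ * m)
    refine ⟨N, fun α V χ hV => ?_⟩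
    obtain ⟨_, -⟩ := exists_wellFoundedLT α
    obtain ⟨C, hCV, hCcard, hC⟩ := hN V χ hV
    obtain ⟨B, hBC, hB⟩ := hC.exists_isMonochromatic hCcard.ge
    exact ⟨B, hBC.trans hCV, hB⟩

theorem exists_orderEmbedding_coloring_eq (κ P Q : Type*) [Finite κ] [LinearOrder P] [Finite P]
    [LinearOrder Q] [Finite Q] :
    ∃ N, ∀ ⦃L : Type u⦄ [LinearOrder L] [Fintype L], N ≤ Fintype.card L →
      ∀ χ : (P ↪o L) → κ, ∃ b : Q ↪o L, ∀ c c' : P ↪o Q, χ (c.trans b) = χ (c'.trans b) := by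
  cases nonempty_fintype P
  cases nonempty_fintype Q
  obtain ⟨N, hN⟩ := exists_cardArrows.{u} (κ := Option κ) (Fintype.card Q) (Fintype.card P)
  refine ⟨N, fun L _ _ hL χ => ?_⟩
  let eP := Fintype.orderIsoFinOfCardEq P rfl
  let eQ := Fintype.orderIsoFinOfCardEq Q rfl
  let χ' (A : Finset L) : Option κ :=
    if hA : #A = Fintype.card P then some (χ (eP.symm.toOrderEmbedding.trans (A.orderEmbOfFin hA)))
    else none
  have hχ' (p : P ↪o L) : χ' (univ.map p.toEmbedding) = some (χ p) := by
    have hA : #(univ.map p.toEmbedding) = Fintype.card P := card_map _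
    have hp : eP.toOrderEmbedding.trans p = (univ.map p.toEmbedding).orderEmbOfFin hA :=
      orderEmbOfFin_unique' hA fun j => mem_map_of_mem _ (mem_univ (eP j))
    simp only [χ', dif_pos hA, ← hp]
    congr 2
    ext x
    exact congrArg p (eP.apply_symm_apply x)
  obtain ⟨B, -, hBcard, i, hi⟩ := hN univ χ' hL
  let b : Q ↪o L := eQ.symm.toOrderEmbedding.trans (B.orderEmbOfFin hBcard)
  have hb (c : P ↪o Q) : some (χ (c.trans b)) = i := by
    rw [← hχ']
    refine hi _ (mem_powersetCard.2 ⟨fun x hx => ?_, card_map _⟩)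
    obtain ⟨p, -, rfl⟩ := mem_map.1 hx
    exact B.orderEmbOfFin_mem hBcard _
  exact ⟨b, fun c c' => Option.some_injective κ ((hb c).trans (hb c').symm)⟩

end Ramsey

namespace OrdUltrametricSpace

/-- Order preserving isometric embeddings, whose ranges are the copies of `X` in `Y`. -/
structure Embedding (X Y : OrdUltrametricSpace.{u}) where
  toFun : X.carrier → Y.carrier
  isometry' : Isometry toFun
  strictMono' : StrictMono toFun

namespace Embedding

variable {X Y Z : OrdUltrametricSpace.{u}}

instance : FunLike (X.Embedding Y) X.carrier Y.carrier where
  coe := toFun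
  coe_injective | ⟨_, _, _⟩, ⟨_, _, _⟩, rfl => rfl

theorem isometry (f : X.Embedding Y) : Isometry f := f.isometry'

theorem strictMono (f : X.Embedding Y) : StrictMono f := f.strictMono'

/-- The composition of embeddings. -/
def comp (g : Y.Embedding Z) (f : X.Embedding Y) : X.Embedding Z :=
  ⟨g ∘ f, g.isometry.comp f.isometry, g.strictMono.comp f.strictMono⟩

/-- An embedding given by its behaviour on the pairs `x < y`. -/
def ofLT (f : X.carrier → Y.carrier)
    (hf : ∀ ⦃x y⦄, x < y → f x < f y ∧ dist (f x) (f y) = dist x y) : X.Embedding Y where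
  toFun := f
  strictMono' _ _ hxy := (hf hxy).1
  isometry' := Isometry.of_dist_eq fun x y => by
    obtain h | rfl | h := lt_trichotomy x y
    · exact (hf h).2
    · rw [dist_self, dist_self]
    · rw [dist_comm, (hf h).2, dist_comm]

theorem range_mem_copies (f : X.Embedding Z) : Set.range f ∈ Z.copies X :=
  ⟨f.strictMono.orderIso, Isometry.of_dist_eq f.isometry.dist_eq⟩

theorem exists_comp_range_eq (g : Y.Embedding Z) {A : Set Z.carrier} (hA : A ∈ Z.copies X)
    (hAg : A ⊆ Set.range g) : ∃ f : X.Embedding Y, Set.range (g.comp f) = A := by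
  obtain ⟨e, he⟩ := hA
  choose f hf using fun x => hAg (e x).2
  refine ⟨⟨f, Isometry.of_dist_eq fun x y => ?_, fun x y hxy => ?_⟩, ?_⟩
  · rw [← g.isometry.dist_eq, hf, hf, ← Subtype.dist_eq, he.dist_eq]
  · rw [← g.strictMono.lt_iff_lt, hf, hf]
    exact e.strictMono hxy
  · calc Set.range (g ∘ f) = Set.range ((↑) ∘ e) := congrArg Set.range (funext hf)
      _ = A := by rw [e.surjective.range_comp, Subtype.range_coe]

end Embedding

theorem arrows_of_forall_embedding_coloring {X Y Z : OrdUltrametricSpace.{u}} {k : ℕ}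
    (h : ∀ χ : X.Embedding Z → Fin k, ∃ g : Y.Embedding Z, ∀ f f' : X.Embedding Y,
      χ (g.comp f) = χ (g.comp f')) : Z.Arrows Y X k := by
  intro χ
  obtain ⟨g, hg⟩ := h fun f => χ ⟨Set.range f, f.range_mem_copies⟩
  refine ⟨Set.range g, g.range_mem_copies, ?_⟩
  rintro ⟨A, hA⟩ ⟨A', hA'⟩ hAg hAg'
  obtain ⟨f, rfl⟩ := g.exists_comp_range_eq hA hAg
  obtain ⟨f', rfl⟩ := g.exists_comp_range_eq hA' hAg'
  exact hg f f'

theorem convexlyOrdered_of_dist_le (X : OrdUltrametricSpace.{u})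
    (h : ∀ a b c : X.carrier, a < b → b < c → dist a b ≤ dist a c) : X.ConvexlyOrdered := by
  have dist_le_max {x a b c : X.carrier} (hb : b ∈ Set.Icc a c) :
      dist b x ≤ max (dist a x) (dist c x) := by
    obtain rfl | hab := hb.1.eq_or_lt
    · exact le_max_left _ _
    obtain rfl | hbc := hb.2.eq_or_lt
    · exact le_max_right _ _
    calc dist b x ≤ max (dist a b) (dist a x) := dist_comm a b ▸ dist_triangle_max b a x
      _ ≤ max (dist a c) (dist a x) := max_le_max_right _ (h a b c hab hbc)
      _ ≤ max (max (dist a x) (dist c x)) (dist a x) :=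
        max_le_max_right _ (dist_comm c x ▸ dist_triangle_max a x c)
      _ = max (dist a x) (dist c x) := by rw [max_comm, max_eq_right (le_max_left _ _)]
  exact fun x r => ⟨⟨fun a ha c hc b hb => (dist_le_max hb).trans_lt (max_lt ha hc)⟩,
    ⟨fun a ha c hc b hb => (dist_le_max hb).trans (max_le ha hc)⟩⟩

section Distances

variable (X : OrdUltrametricSpace.{u})

/-- The set of distances between distinct points of `X`, as positive real numbers. -/
def distances : Set (Set.Ioi (0 : ℝ)) :=
  (↑) ⁻¹' Set.range fun p : X.carrier × X.carrier => dist p.1 p.2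

instance [Finite X.carrier] : Finite X.distances :=
  ((Set.finite_range _).preimage Subtype.val_injective.injOn).to_subtype

variable {X}

theorem DistancesIn.coe_mem_of_mem_distances {S : Set ℝ} (hX : X.DistancesIn S)
    {s : Set.Ioi (0 : ℝ)} (hs : s ∈ X.distances) : (s : ℝ) ∈ S := by
  obtain ⟨⟨x, y⟩, hxy⟩ := hs
  have hxy : dist x y = s := hxy
  exact hxy ▸ hX x y (dist_pos.1 (hxy ▸ s.2))

theorem exists_coe_eq_dist {D : Set (Set.Ioi (0 : ℝ))} (hD : X.distances ⊆ D) {x y : X.carrier}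
    (hxy : x ≠ y) : ∃ s : D, (s : ℝ) = dist x y :=
  ⟨⟨⟨dist x y, dist_pos.2 hxy⟩, hD ⟨(x, y), rfl⟩⟩, rfl⟩

end Distances

section Colex

variable {D : Set (Set.Ioi (0 : ℝ))} {L : Type*}

/-- The largest element of `D` at which two functions differ, or `0` if they are equal: the
supremum of the empty set of reals is `0`. -/
noncomputable def diffDist (u v : D → L) : ℝ :=
  sSup ((fun s : D => (s : ℝ)) '' {s | u s ≠ v s})

theorem diffDist_nonneg (u v : D → L) : 0 ≤ diffDist u v :=
  Real.sSup_nonneg (Set.forall_mem_image.2 fun s _ => s.1.2.le)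

theorem diffDist_self (u : D → L) : diffDist u u = 0 := by
  simp [diffDist]

theorem diffDist_comm (u v : D → L) : diffDist u v = diffDist v u := by
  simp only [diffDist, ne_comm]

variable [Finite D]

theorem le_diffDist {u v : D → L} {s : D} (hs : u s ≠ v s) : (s : ℝ) ≤ diffDist u v :=
  le_csSup (Set.toFinite _).bddAbove (Set.mem_image_of_mem _ hs)

theorem diffDist_eq_of_forall_gt {u v : D → L} {s : D} (hs : u s ≠ v s)
    (hgt : ∀ t > s, u t = v t) : diffDist u v = s :=
  have hle : ∀ t : D, u t ≠ v t → (t : ℝ) ≤ s := fun t ht => le_of_not_gt fun h => ht (hgt t h)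
  le_antisymm (Real.sSup_le (Set.forall_mem_image.2 hle) s.1.2.le) (le_diffDist hs)

theorem diffDist_triangle_max (u v w : D → L) :
    diffDist u w ≤ max (diffDist u v) (diffDist v w) := by
  refine Real.sSup_le (Set.forall_mem_image.2 fun s hs => ?_)
    (le_max_of_le_left (diffDist_nonneg u v))
  by_cases huv : u s = v s
  · exact le_max_of_le_right (le_diffDist (huv ▸ hs))
  · exact le_max_of_le_left (le_diffDist huv)

theorem eq_of_diffDist_eq_zero {u v : D → L} (h : diffDist u v = 0) : u = v := by
  by_contra hne
  obtain ⟨s, hs⟩ := Function.ne_iff.1 hne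
  exact ((le_diffDist hs).trans_eq h).not_gt s.1.2

variable (D) (L : Type u) [LinearOrder L]

/-- The functions `D → L`, ordered by the values at the largest element of `D` at which they
differ, and with that element as distance: the leaves of a tree with levels `D` in which
the children of every vertex are labelled by `L`. -/
noncomputable def colexSpace : OrdUltrametricSpace.{u} :=
  letI : MetricSpace (Colex (D → L)) :=
    { dist u v := diffDist (ofColex u) (ofColex v)
      dist_self _ := diffDist_self _
      dist_comm _ _ := diffDist_comm _ _
      dist_triangle _ _ _ := (diffDist_triangle_max _ _ _).trans
        (max_le_add_of_nonneg (diffDist_nonneg _ _) (diffDist_nonneg _ _))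
      eq_of_dist_eq_zero := eq_of_diffDist_eq_zero }
  { carrier := Colex (D → L)
    isUltrametricDist := ⟨fun _ _ _ => diffDist_triangle_max _ _ _⟩ }

variable {D L}

theorem colexSpace_dist_eq {u v : (colexSpace D L).carrier} {s : D}
    (hs : ofColex u s ≠ ofColex v s) (hgt : ∀ t > s, ofColex u t = ofColex v t) :
    dist u v = s :=
  diffDist_eq_of_forall_gt hs hgt

theorem le_colexSpace_dist {u v : (colexSpace D L).carrier} {s : D}
    (hs : ofColex u s ≠ ofColex v s) : (s : ℝ) ≤ dist u v :=
  le_diffDist hs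

theorem colexSpace_lt_iff {u v : (colexSpace D L).carrier} :
    u < v ↔ ∃ s : D, (∀ t > s, ofColex u t = ofColex v t) ∧ ofColex u s < ofColex v s :=
  Iff.rfl

theorem convexlyOrdered_colexSpace : (colexSpace D L).ConvexlyOrdered := by
  refine convexlyOrdered_of_dist_le _ fun a b c hab hbc => ?_
  obtain ⟨s, hs, hslt⟩ := colexSpace_lt_iff.1 hab
  obtain ⟨t, ht, htlt⟩ := colexSpace_lt_iff.1 hbc
  rw [colexSpace_dist_eq hslt.ne hs]
  obtain hst | rfl | hts := lt_trichotomy s t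
  · calc (s : ℝ) ≤ t := hst.le
      _ ≤ dist a c := le_colexSpace_dist (hs t hst ▸ htlt.ne)
  · exact le_colexSpace_dist (hslt.trans htlt).ne
  · exact le_colexSpace_dist (ht s hts ▸ hslt.ne)

theorem distancesIn_colexSpace : (colexSpace D L).DistancesIn ((↑) '' D) := by
  intro u v huv
  wlog hlt : u < v generalizing u v
  · exact dist_comm u v ▸ this v u huv.symm (lt_of_le_of_ne (not_lt.1 hlt) huv.symm)
  obtain ⟨s, hs, hslt⟩ := colexSpace_lt_iff.1 hlt
  exact ⟨s, s.2, (colexSpace_dist_eq hslt.ne hs).symm⟩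

theorem colexSpace_mem_finiteConvexlyOrdered [Finite L] {S : Set ℝ} (hDS : ∀ s ∈ D, (s : ℝ) ∈ S) :
    colexSpace D L ∈ finiteConvexlyOrdered S :=
  ⟨inferInstanceAs (Finite (D → L)), convexlyOrdered_colexSpace, fun u v huv =>
    Set.image_subset_iff.2 hDS (distancesIn_colexSpace u v huv)⟩

end Colex

section Balls

variable {X Y : OrdUltrametricSpace.{u}} [Finite X.carrier] [Finite Y.carrier]

/-- The least point of the open ball of radius `s` around `x`, which represents that ball. -/
noncomputable def ballMin (s : Set.Ioi (0 : ℝ)) (x : X.carrier) : X.carrier :=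
  wellFounded_lt.min (Metric.ball x s) ⟨x, Metric.mem_ball_self s.2⟩

theorem ballMin_mem_ball (s : Set.Ioi (0 : ℝ)) (x : X.carrier) : ballMin s x ∈ Metric.ball x s :=
  wellFounded_lt.min_mem _ _

theorem ballMin_le (s : Set.Ioi (0 : ℝ)) (x : X.carrier) : ballMin s x ≤ x :=
  wellFounded_lt.min_le (Metric.mem_ball_self s.2)

theorem ballMin_eq_ballMin {s : Set.Ioi (0 : ℝ)} {x y : X.carrier} (h : dist x y < s) :
    ballMin s x = ballMin s y := by
  simp only [ballMin, IsUltrametricDist.ball_eq_of_mem (Metric.mem_ball'.2 h)]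

theorem ballMin_lt_ballMin (hX : X.ConvexlyOrdered) {s : Set.Ioi (0 : ℝ)} {x y : X.carrier}
    (hxy : x < y) (h : s ≤ dist x y) : ballMin s x < ballMin s y := by
  by_contra! hle
  have hx : x ∈ Metric.ball y s := (hX y s).1.out (ballMin_mem_ball s y)
    (Metric.mem_ball_self s.2) ⟨hle.trans (ballMin_le s x), hxy.le⟩
  exact h.not_gt hx

theorem ballMin_lt_ballMin_iff (hX : X.ConvexlyOrdered) {s : Set.Ioi (0 : ℝ)} {x y : X.carrier} :
    ballMin s x < ballMin s y ↔ x < y ∧ s ≤ dist x y := by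
  refine ⟨fun h => ?_, fun h => ballMin_lt_ballMin hX h.1 h.2⟩
  have hdist : s ≤ dist x y := le_of_not_gt fun hlt => h.ne (ballMin_eq_ballMin hlt)
  refine ⟨lt_of_not_ge fun hyx => ?_, hdist⟩
  obtain rfl | hlt := hyx.eq_or_lt
  · exact h.false
  · exact h.not_gt (ballMin_lt_ballMin hX hlt (dist_comm x y ▸ hdist))

variable {D : Set (Set.Ioi (0 : ℝ))}

variable (X D) in
/-- The pairs of a level `s ∈ D` and an open ball of radius `s` in `X`, the ball being encoded by
its least point, ordered by level and within a level by these points. -/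
abbrev Ball : Type u := Set.range fun p : D × X.carrier => toLex (p.1, ballMin p.1 p.2)

/-- The ball of level `s` around `x`. -/
noncomputable def ballAt (s : D) (x : X.carrier) : X.Ball D := ⟨_, (s, x), rfl⟩

theorem ballAt_eq_ballAt {s : D} {x y : X.carrier} (h : dist x y < s) :
    ballAt s x = ballAt s y := by
  simp only [ballAt, ballMin_eq_ballMin h]

theorem ballAt_lt_ballAt_iff (hX : X.ConvexlyOrdered) {s t : D} {x y : X.carrier} :
    ballAt s x < ballAt t y ↔ s < t ∨ s = t ∧ x < y ∧ s ≤ dist x y := by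
  refine Prod.Lex.toLex_lt_toLex.trans (or_congr_right (and_congr_right fun hst : s = t => ?_))
  subst hst
  exact ballMin_lt_ballMin_iff hX

theorem exists_ballAt_lt_ballAt (hX : X.ConvexlyOrdered) (hD : X.distances ⊆ D) {x y : X.carrier}
    (hxy : x < y) : ∃ s : D, (s : ℝ) = dist x y ∧
      (∀ t > s, ballAt t x = ballAt t y) ∧ ballAt s x < ballAt s y := by
  obtain ⟨s, hs⟩ := exists_coe_eq_dist hD hxy.ne
  exact ⟨s, hs, fun t ht => ballAt_eq_ballAt (hs ▸ ht),
    (ballAt_lt_ballAt_iff hX).2 (Or.inr ⟨rfl, hxy, hs.le⟩)⟩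

theorem Embedding.ballAt_apply_ballMin (f : X.Embedding Y) (s : D) (x : X.carrier) :
    ballAt s (f (ballMin s x)) = ballAt s (f x) :=
  ballAt_eq_ballAt (by rw [f.isometry.dist_eq]; exact ballMin_mem_ball s.1 x)

/-- The map on balls induced by an embedding `f`, sending the ball around `x` to the ball of the
same radius around `f x`. -/
noncomputable def Embedding.ballMap (f : X.Embedding Y) (hX : X.ConvexlyOrdered)
    (hY : Y.ConvexlyOrdered) : X.Ball D ↪o Y.Ball D :=
  OrderEmbedding.ofStrictMono (fun b => ballAt (ofLex b.1).1 (f (ofLex b.1).2)) <| by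
    rintro ⟨_, ⟨s, x⟩, rfl⟩ ⟨_, ⟨t, y⟩, rfl⟩ hlt
    simp only [ofLex_toLex, f.ballAt_apply_ballMin]
    rw [ballAt_lt_ballAt_iff hY, f.isometry.dist_eq, f.strictMono.lt_iff_lt]
    exact (ballAt_lt_ballAt_iff hX).1 hlt

theorem Embedding.ballMap_ballAt (f : X.Embedding Y) (hX : X.ConvexlyOrdered)
    (hY : Y.ConvexlyOrdered) (s : D) (x : X.carrier) :
    f.ballMap hX hY (ballAt s x) = ballAt s (f x) :=
  f.ballAt_apply_ballMin s x

variable [Finite D] {L : Type u} [LinearOrder L]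

/-- The embedding into `colexSpace D L` given by an increasing labelling of the balls of `X`: a
point is sent to the labels of the balls around it. -/
noncomputable def ofBallLabelling (hX : X.ConvexlyOrdered) (hD : X.distances ⊆ D)
    (b : X.Ball D ↪o L) : X.Embedding (colexSpace D L) :=
  .ofLT (fun x => toColex fun s => b (ballAt s x)) fun _ _ hxy =>
    let ⟨s, hs, hgt, hlt⟩ := exists_ballAt_lt_ballAt hX hD hxy
    have hgt : ∀ t > s, b (ballAt t _) = b (ballAt t _) := fun t ht => congrArg b (hgt t ht)
    have hlt : b (ballAt s _) < b (ballAt s _) := b.strictMono hlt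
    ⟨colexSpace_lt_iff.2 ⟨s, hgt, hlt⟩, (colexSpace_dist_eq hlt.ne hgt).trans hs⟩

theorem ofBallLabelling_comp (f : X.Embedding Y) (hX : X.ConvexlyOrdered) (hY : Y.ConvexlyOrdered)
    (hXD : X.distances ⊆ D) (hYD : Y.distances ⊆ D) (b : Y.Ball D ↪o L) :
    (ofBallLabelling hY hYD b).comp f = ofBallLabelling hX hXD ((f.ballMap hX hY).trans b) :=
  DFunLike.ext _ _ fun x => funext fun s => congrArg b (f.ballMap_ballAt hX hY s x).symm

end Balls

end OrdUltrametricSpace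

open OrdUltrametricSpace in
theorem mainTheorem2 (S : Set ℝ) (hS : S ⊆ Set.Ioi 0) :
    OrdUltrametricSpace.RamseyProperty.{u}
      (OrdUltrametricSpace.finiteConvexlyOrdered.{u} S) := by
  rintro X ⟨_, hX, hXS⟩ Y ⟨_, hY, hYS⟩ k -
  let D := X.distances ∪ Y.distances
  have hXD : X.distances ⊆ D := Set.subset_union_left
  have hYD : Y.distances ⊆ D := Set.subset_union_right
  have hDS : ∀ s ∈ D, (s : ℝ) ∈ S := fun _ hs =>
    hs.elim hXS.coe_mem_of_mem_distances hYS.coe_mem_of_mem_distances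
  obtain ⟨N, hN⟩ := exists_orderEmbedding_coloring_eq.{u} (Fin k) (X.Ball D) (Y.Ball D)
  let L := ULift.{u} (Fin N)
  refine ⟨colexSpace D L, colexSpace_mem_finiteConvexlyOrdered hDS,
    arrows_of_forall_embedding_coloring fun χ => ?_⟩
  obtain ⟨b, hb⟩ := hN (L := L) (by simp [L]) fun c => χ (ofBallLabelling hX hXD c)
  refine ⟨ofBallLabelling hY hYD b, fun f f' => ?_⟩
  rw [ofBallLabelling_comp f hX hY hXD, ofBallLabelling_comp f' hX hY hXD]
  exact hb (f.ballMap hX hY) (f'.ballMap hX hY)
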